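/- **Setting.** Let $\mathcal P=(Q,\Gamma,\Delta,q_{\rm in})$ be a pushdown system with finite $Q,\Gamma$, bottom symbol $\bot\notin\Gamma$, $\Gamma_\bot=\Gamma\cup\{\bot\}$, $\Delta\subseteq Q\times\Gamma_\bot\times Q\times\Gamma_\bot^{\le 2}$, such that $\bot$ is never written nor deleted and for all $q\in Q$, $A\in\Gamma_\bot$ some transition $(q,A,p,\alpha)$ is in $\Delta$. Let $Q=Q_0\cup Q_1$ be a partition and $\mathrm{col}:Q\to[n]=\{0,\dots,n-1\}$. The *pushdown game* $\mathcal G$ is the min-parity game on the configurations $(q,\gamma)$, $\gamma\in\Gamma^*\bot$ (top of the stack leftmost), with an edge $(q,A\gamma)\to(p,\alpha\gamma)$ for each $(q,A,p,\alpha)\in\Delta$, initial vertex $(q_{\rm in},\bot)$, and with the owner and colour of $(q,\gamma)$ given by $q$. The stack height is $\mathrm{sh}(q,\gamma)=|\gamma|-1$. In a min-parity game, a play is won by Player $j\in\{0,1\}$ iff the least colour seen infinitely often has parity $j$. A play prefix is a nonempty finite path from the initial vertex. A strategy for Player $j$ maps each word ending in a vertex of Player $j$ to a successor of this vertex; it is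 positional if its value depends only on the last vertex. **Scores.** For a colour $c$, $\mathsf{Sc}_c(\varepsilon)=0$, and $\mathsf{Sc}_c(wv)$ is $\mathsf{Sc}_c(w)$, $\mathsf{Sc}_c(w)+1$ or $0$ according as the colour of $v$ is $>c$, $=c$ or $<c$. For a nonempty path $w=w(0)\cdots w(r)$ of configurations starting with stack height $0$, let $\mathsf{Reset}(w)=\varepsilon$ and $\mathsf{lastBump}(w)=w$ if $r=0$; otherwise $\mathsf{Reset}(w)=w(0)\cdots w(l)$ and $\mathsf{lastBump}(w)=w(l+1)\cdots w(r)$ with $l<r$ greatest such that $\mathrm{sh}(w(l))\le\mathrm{sh}(w(r))$. Put $\mathsf{StairSc}_c(\varepsilon)=0$, and let $\mathsf{StairSc}_c(w)$ be $\mathsf{StairSc}_c(\mathsf{Reset}(w))$, $\mathsf{StairSc}_c(\mathsf{Reset}(w))+1$ or $0$ according as the least colour in $\mathsf{lastBump}(w)$ is $>c$, $=c$ or $<c$. **The finite game.** Let $i\in\{0,1\}$ and $\mathsf{Pred}=(2^Q)^n$. The min-parity game $\mathcal G'_i$ with colours $[n+1]$ has the vertices $\mathsf{Check}[q,A,P,c,d]$,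 $\mathsf{Push}[P,c,q,AB]$, $\mathsf{Claim}[P,c,q,AB,R]$, $\mathsf{Jump}[q,A,P,c,d]$, $\mathsf{Win}_j[q]$ for $q\in Q$, $A,B\in\Gamma_\bot$, $c,d\in[n]$, $P,R\in\mathsf{Pred}$, $j\in\{0,1\}$, and the edges - $\mathsf{Check}[q,A,P,c,d]\to\mathsf{Check}[p,B,P,\min\{c,\mathrm{col}(p)\},\mathrm{col}(p)]$ for $(q,A,p,B)\in\Delta$; - $\mathsf{Check}[q,A,P,c,d]\to\mathsf{Push}[P,c,p,BC]$ for $(q,A,p,BC)\in\Delta$; - $\mathsf{Push}[P,c,p,BC]\to\mathsf{Claim}[P,c,p,BC,R]$ for all $R$; - $\mathsf{Claim}[P,c,p,BC,R]\to\mathsf{Check}[p,B,R,\mathrm{col}(p),\mathrm{col}(p)]$; - $\mathsf{Claim}[P,c,p,BC,R]\to\mathsf{Jump}[q,C,P,c,e]$ for $e\in[n]$, $q\in R_e$; - $\mathsf{Jump}[q,C,P,c,e]\to\mathsf{Check}[q,C,P,\min\{c,e,\mathrm{col}(q)\},\min\{e,\mathrm{col}(q)\}]$; - for $(q,A,p,\varepsilon)\in\Delta$: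 $\mathsf{Check}[q,A,P,c,d]\to\mathsf{Win}_i[p]$ if $p\in P_c$, and $\to\mathsf{Win}_{1-i}[p]$ if $p\notin P_c$; - $\mathsf{Win}_j[q]\to\mathsf{Win}_j[q]$. The initial vertex is $\mathsf{Check}[q_{\rm in},\bot,(\emptyset,\dots,\emptyset),\mathrm{col}(q_{\rm in}),\mathrm{col}(q_{\rm in})]$. Player $i$ (the predicting player) owns all $\mathsf{Push}$-vertices and the $\mathsf{Check}[q,\dots]$ with $q\in Q_i$; Player $1-i$ owns all other vertices. The colour of $\mathsf{Check}[q,A,P,c,d]$ is $d$, that of $\mathsf{Win}_j[q]$ is $j$, and all other vertices have colour $n$. **The pushdown strategy.** Let $\sigma'_i$ be a positional winning strategy for Player $i$ in $\mathcal G'_i$. Let $V'|_{\sigma'_i}$ and $E'|_{\sigma'_i}$ be the sets of vertices and edges occurring in plays consistent with $\sigma'_i$. Label an edge of $E'|_{\sigma'_i}$ by $\ell=(q,A,p,B)$ if it is $\mathsf{Check}[q,A,\dots]\to\mathsf{Check}[p,B,\dots]$, by $(q,A,p,BC)$ if it is $\mathsf{Check}[q,A,\dots]\to\mathsf{Push}[\cdot,\cdot,p,BC]$,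 by $(q,A,p,\varepsilon)$ if it is $\mathsf{Check}[q,A,\dots]\to\mathsf{Win}_i[p]$, and by $\varepsilon$ otherwise. The pushdown transducer $\mathcal T_\sigma$ has state set $V'|_{\sigma'_i}$, as initial state the initial vertex, as stack symbols the $\mathsf{Claim}$-vertices in $V'|_{\sigma'_i}$ and a bottom symbol, and input and output alphabet $\Delta$. For each edge $(v,v')\in E'|_{\sigma'_i}$ it has the following transitions, all reading $\ell(v,v')$: - if $v$ is not a $\mathsf{Claim}$-vertex and $v'$ is not a $\mathsf{Win}_i$-vertex: go from $v$ to $v'$, leaving the stack unchanged; - if $v$ is a $\mathsf{Claim}$- and $v'$ a $\mathsf{Check}$-vertex: go from $v$ to $v'$ and push $v$; - if $v=\mathsf{Check}[q,A,P,c,d]$ and $v'=\mathsf{Win}_i[p]$: for each stack symbol $\mathsf{Claim}[R,e,q',BC,R']$ such that $\mathsf{Jump}[p,C,R,e,c]\in V'|_{\sigma'_i}$, pop this symbol and go from $v$ to $\mathsf{Jump}[p,C,R,e,c]$. At a $\mathsf{Check}$-vertex $v$ of Player $i$ the output is $\ell(v,v')$, where $(v,v')$ is the edge chosen by $\sigma'_i$.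 On an input word, the transducer outputs the output at the last state of its run on this word, where a run continues until the word is read and no $\varepsilon$-transition is possible. Let $\sigma$ be the strategy for Player $i$ in $\mathcal G$ which, after a play prefix ending in a configuration of Player $i$, performs the transition output by $\mathcal T_\sigma$ on the sequence of transitions inducing this play prefix (and moves to an arbitrary successor if there is no such executable output). **Claim.** For every play prefix $w$ in $\mathcal G$ that is consistent with $\sigma$ there is a play prefix $w'$ in $\mathcal G'_i$ that is consistent with $\sigma'_i$ such that $$\mathsf{StairSc}_c(w)=\mathsf{Sc}_c(w')\qquad\text{for every } c\in[n].$$ -/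

import Mathlib

namespace PushdownScores

open Filter

/-! ### Parity games -/

/-- A (min-)parity game with vertex set `V`, colours `[n] = Fin n`, and players `0, 1 : Fin 2`:
`owner` is the partition `V = V₀ ∪ V₁`, and every vertex has an outgoing edge. -/
structure ParityGame (V : Type*) (n : ℕ) where
  owner : V → Fin 2
  edge : V → V → Prop
  init : V
  exists_edge : ∀ v, ∃ v', edge v v'
  col : V → Fin n

namespace ParityGame

variable {V : Type*} {n : ℕ} (G : ParityGame V n)

/-- A play: an infinite path that starts in the initial vertex. -/
def IsPlay (ρ : ℕ → V) : Prop :=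
  ρ 0 = G.init ∧ ∀ m, G.edge (ρ m) (ρ (m + 1))

/-- A play prefix: a finite nonempty path that starts in the initial vertex. -/
def IsPlayPrefix (w : List V) : Prop :=
  w.head? = some G.init ∧ w.IsChain G.edge

/-- The colours seen infinitely often. -/
def infColors (ρ : ℕ → V) : Set (Fin n) :=
  {c | ∃ᶠ m in atTop, G.col (ρ m) = c}

/-- `ρ` is winning for Player `i`: the minimal colour seen infinitely often has parity `i`. -/
def WonBy (i : Fin 2) (ρ : ℕ → V) : Prop :=
  ∃ c, IsLeast (G.infColors ρ) c ∧ c.val % 2 = i.val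

/-- A strategy for Player `i`, i.e. a function on `V* Vᵢ`. A word of `V* Vᵢ` is given by the word
in `V*` and its last letter in `Vᵢ`. -/
structure Strategy (i : Fin 2) where
  move : List V → {v : V // G.owner v = i} → V
  legal : ∀ w v, G.edge v.1 (move w v)

namespace Strategy

variable {G} {i : Fin 2} (σ : G.Strategy i)

def Positional : Prop :=
  ∀ w w' v, σ.move w v = σ.move w' v

/-- An infinite sequence of vertices is consistent with `σ`. -/
def ConsistentPlay (ρ : ℕ → V) : Prop :=
  ∀ (m : ℕ) (h : G.owner (ρ m) = i), ρ (m + 1) = σ.move ((List.range m).map ρ) ⟨ρ m, h⟩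

/-- A finite sequence of vertices is consistent with `σ`. -/
def Consistent (w : List V) : Prop :=
  ∀ (u : List V) (v v' : V) (h : G.owner v = i), u ++ [v, v'] <+: w → v' = σ.move u ⟨v, h⟩

/-- `σ` is a winning strategy. -/
def Winning : Prop :=
  ∀ ρ, G.IsPlay ρ → σ.ConsistentPlay ρ → G.WonBy i ρ

/-- The vertices that occur in play prefixes consistent with `σ`. -/
def Visits (v : V) : Prop :=
  ∃ w, G.IsPlayPrefix w ∧ σ.Consistent w ∧ v ∈ w

/-- The edges that are taken in play prefixes consistent with `σ`. -/
def VisitsEdge (v v' : V) : Prop :=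
  ∃ w, G.IsPlayPrefix w ∧ σ.Consistent w ∧ [v, v'] <:+: w

end Strategy

end ParityGame

/-! ### Scores and stair-scores -/

section Scores

variable {V : Type*} {n : ℕ}

/-- The score `Sc_c`: reading a vertex of colour greater than `c` keeps it, reading colour `c`
increments it, reading a smaller colour resets it to `0`. -/
def score (col : V → Fin n) (c : Fin n) (w : List V) : ℕ :=
  w.foldl (fun s v => if c < col v then s else if col v = c then s + 1 else 0) 0

/-- The minimal colour of a nonempty word. -/
def minCol (col : V → Fin n) (w : List V) (hw : w ≠ []) : Fin n :=
  (w.map col).min (by simpa using hw)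

/-- `Reset(w)`: the prefix of `w` up to and including the greatest position `l`, other than the last
position `r`, whose stack height is at most that of position `r`. (It is empty if `w` has length
one, or if there is no such `l`, which does not happen on longer words that start with stack
height `0`.) -/
def reset (sh : V → ℕ) (w : List V) (hw : w ≠ []) : List V :=
  w.dropLast.rdropWhile (fun x => sh (w.getLast hw) < sh x)

/-- `lastBump(w)`: the remaining suffix, i.e. `w = Reset(w) lastBump(w)`. -/
def lastBump (sh : V → ℕ) (w : List V) (hw : w ≠ []) : List V :=
  w.dropLast.rtakeWhile (fun x => sh (w.getLast hw) < sh x) ++ [w.getLast hw]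

theorem lastBump_ne_nil (sh : V → ℕ) (w : List V) (hw : w ≠ []) : lastBump sh w hw ≠ [] := by
  simp [lastBump]

theorem reset_append_lastBump (sh : V → ℕ) (w : List V) (hw : w ≠ []) :
    reset sh w hw ++ lastBump sh w hw = w := by
  unfold reset lastBump List.rdropWhile List.rtakeWhile
  rw [← List.append_assoc, ← List.reverse_append, List.takeWhile_append_dropWhile,
    List.reverse_reverse, List.dropLast_append_getLast hw]

theorem length_reset_lt (sh : V → ℕ) (w : List V) (hw : w ≠ []) :
    (reset sh w hw).length < w.length := by
  have h := congrArg List.length (reset_append_lastBump sh w hw)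
  have h' := List.length_pos_iff.mpr (lastBump_ne_nil sh w hw)
  rw [List.length_append] at h
  omega

/-- The stair-score `StairSc_c` with respect to the stack height function `sh`. -/
def stairScore (sh : V → ℕ) (col : V → Fin n) (c : Fin n) (w : List V) : ℕ :=
  if hw : w = [] then 0
  else if c < minCol col (lastBump sh w hw) (lastBump_ne_nil sh w hw) then
    stairScore sh col c (reset sh w hw)
  else if minCol col (lastBump sh w hw) (lastBump_ne_nil sh w hw) = c then
    stairScore sh col c (reset sh w hw) + 1
  else 0
termination_by w.length
decreasing_by all_goals exact length_reset_lt sh w hw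

end Scores

/-! ### Pushdown systems and pushdown games -/

section Pushdown

/-- A transition `(q, A, p, α)`; the stack symbols are `Γ_⊥ = WithBot Γ`. -/
@[ext] structure Transition (Q Γ : Type*) where
  src : Q
  top : WithBot Γ
  tgt : Q
  word : List (WithBot Γ)

/-- `A` may be replaced by `α` on top of the stack: `|α| ≤ 2`, and the bottom symbol is neither
written nor deleted. -/
def LegalWrite {Γ : Type*} (A : WithBot Γ) (α : List (WithBot Γ)) : Prop :=
  α.length ≤ 2 ∧
  (A = ⊥ → ∃ β : List Γ, α = β.map (fun B => (B : WithBot Γ)) ++ [⊥]) ∧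
  (A ≠ ⊥ → ∃ β : List Γ, α = β.map (fun B => (B : WithBot Γ)))

/-- A deadlock-free pushdown system with states `Q`, stack alphabet `Γ` and transitions `trans`. -/
structure PDS (Q Γ : Type*) where
  init : Q
  trans : Set (Transition Q Γ)
  legal : ∀ δ ∈ trans, LegalWrite δ.top δ.word
  deadlockFree : ∀ q A, ∃ p α, (⟨q, A, p, α⟩ : Transition Q Γ) ∈ trans

/-- A configuration: a state and a stack content in `Γ* ⊥`, given by its part in `Γ*`, with the
topmost symbol first. -/
@[ext] structure Config (Q Γ : Type*) where
  state : Q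
  stack : List Γ

namespace Config

variable {Q Γ : Type*}

/-- The stack content in `Γ* ⊥`. -/
def content (v : Config Q Γ) : List (WithBot Γ) :=
  v.stack.map (fun B => (B : WithBot Γ)) ++ [⊥]

/-- The topmost stack symbol. -/
def top (v : Config Q Γ) : WithBot Γ :=
  v.content.head (by simp [content])

/-- The stack height. -/
def sh (v : Config Q Γ) : ℕ := v.content.length - 1

/-- The transition `δ` leads from `v` to `v'`. -/
def Fires (δ : Transition Q Γ) (v v' : Config Q Γ) : Prop :=
  v.state = δ.src ∧ v.top = δ.top ∧ v'.state = δ.tgt ∧ v'.content = δ.word ++ v.content.tail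

theorem exists_fires {δ : Transition Q Γ} (hδ : LegalWrite δ.top δ.word) {v : Config Q Γ}
    (h1 : v.state = δ.src) (h2 : v.top = δ.top) : ∃ v', Fires δ v v' := by
  obtain ⟨q, γ⟩ := v
  obtain ⟨-, hb, hn⟩ := hδ
  cases γ with
  | nil =>
    obtain ⟨β, hβ⟩ := hb (by rw [← h2]; rfl)
    exact ⟨⟨δ.tgt, β⟩, h1, h2, rfl, by simp [content, hβ]⟩
  | cons A γ =>
    obtain ⟨β, hβ⟩ := hn (by rw [← h2]; exact WithBot.coe_ne_bot)
    exact ⟨⟨δ.tgt, β ++ γ⟩, h1, h2, rfl, by simp [content, hβ]⟩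

end Config

variable {Q Γ : Type*} {n : ℕ}

/-- The pushdown game of a pushdown system with a partition `owner` and a colouring `col` of the
states. -/
def pushdownGame (P : PDS Q Γ) (owner : Q → Fin 2) (col : Q → Fin n) :
    ParityGame (Config Q Γ) n where
  owner v := owner v.state
  edge v v' := ∃ δ ∈ P.trans, Config.Fires δ v v'
  init := ⟨P.init, []⟩
  exists_edge v := by
    obtain ⟨p, α, h⟩ := P.deadlockFree v.state v.top
    obtain ⟨v', hv'⟩ := Config.exists_fires (P.legal _ h) (v := v) rfl rfl
    exact ⟨v', _, h, hv'⟩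
  col v := col v.state

/-- `Induces P w d`: the finite path `w` in the pushdown graph is induced by the sequence `d` of
transitions. -/
inductive Induces (P : PDS Q Γ) : List (Config Q Γ) → List P.trans → Prop
  | single (v : Config Q Γ) : Induces P [v] []
  | snoc (w : List (Config Q Γ)) (v v' : Config Q Γ) (d : List P.trans) (δ : P.trans) :
      Induces P (w ++ [v]) d → Config.Fires δ.1 v v' → Induces P (w ++ [v, v']) (d ++ [δ])

/-! ### Pushdown transducers -/

/-- A pushdown transducer with input alphabet `I` and output alphabet `O`; `trans q A a p α` is
`(q, A, a, p, α) ∈ Δ`, where `a = none` stands for `a = ε`, and `out` is the partial output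
function. -/
structure PDT (Q Γ I O : Type*) where
  init : Q
  trans : Q → WithBot Γ → Option I → Q → List (WithBot Γ) → Prop
  legal : ∀ q A a p α, trans q A a p α → LegalWrite A α
  out : Q → Option O

namespace PDT

variable {I O : Type*} (T : PDT Q Γ I O)

/-- One step of the transducer, labelled by a letter or by `ε`. -/
def Step (κ : Config Q Γ) (a : Option I) (κ' : Config Q Γ) : Prop :=
  ∃ α, T.trans κ.state κ.top a κ'.state α ∧ κ'.content = α ++ κ.content.tail

/-- `T` can reach `κ` from its initial configuration while reading exactly `w`. -/
inductive Reads : List I → Config Q Γ → Prop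
  | start : Reads [] ⟨T.init, []⟩
  | step (w : List I) (κ κ' : Config Q Γ) (a : Option I) :
      Reads w κ → T.Step κ a κ' → Reads (w ++ a.toList) κ'

/-- `κ` is the last configuration of a run of `T` on `w`; no `ε`-transition is possible there. -/
def RunEndsIn (w : List I) (κ : Config Q Γ) : Prop :=
  T.Reads w κ ∧ ∀ p α, ¬ T.trans κ.state κ.top none p α

/-- The function computed by `T` is defined at `w`, with value `b`. -/
def Outputs (w : List I) (b : O) : Prop :=
  ∃ κ, T.RunEndsIn w κ ∧ T.out κ.state = some b

end PDT

open Classical in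
/-- The strategy for Player `i` in the pushdown game implemented by a transducer that reads play
prefixes as sequences of transitions and outputs transitions: after `w v`, with `v` a vertex of
Player `i`, it applies to `v` the transition that the transducer outputs on the transition sequence
of `w v`. Where there is no executable output, an arbitrary successor is chosen, so that the
strategy is a total function. -/
noncomputable def transducerStrategy (P : PDS Q Γ) (owner : Q → Fin 2) (col : Q → Fin n)
    (i : Fin 2) {Q' Γ' : Type*} (T : PDT Q' Γ' P.trans P.trans) :
    (pushdownGame P owner col).Strategy i where
  move w v :=
    if h : ∃ v', ∃ d δ, Induces P (w ++ [v.1]) d ∧ T.Outputs d δ ∧ Config.Fires δ.1 v.1 v' then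
      h.choose
    else ((pushdownGame P owner col).exists_edge v.1).choose
  legal w v := by
    split
    · next h =>
      obtain ⟨d, δ, -, -, hδ⟩ := h.choose_spec
      exact ⟨δ.1, δ.2, hδ⟩
    · exact ((pushdownGame P owner col).exists_edge v.1).choose_spec

end Pushdown

/-! ### The finite game -/

section Walukiewicz

variable {Q Γ : Type*} {n : ℕ}

/-- Predictions `(P_0, …, P_{n-1})` with `P_c ⊆ Q`. -/
abbrev Pred (Q : Type*) (n : ℕ) := Fin n → Set Q

/-- The vertices `Check[q,A,P,c,d]`, `Push[P,c,q,AB]`, `Claim[P,c,q,AB,R]`, `Jump[q,A,P,c,d]` and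
`Win_j[q]` of the finite game. -/
inductive Vertex (Q Γ : Type*) (n : ℕ)
  | check (q : Q) (A : WithBot Γ) (P : Pred Q n) (c d : Fin n)
  | push (P : Pred Q n) (c : Fin n) (q : Q) (A B : WithBot Γ)
  | claim (P : Pred Q n) (c : Fin n) (q : Q) (A B : WithBot Γ) (R : Pred Q n)
  | jump (q : Q) (A : WithBot Γ) (P : Pred Q n) (c d : Fin n)
  | win (j : Fin 2) (q : Q)

namespace Vertex

def IsCheck (v : Vertex Q Γ n) : Prop := ∃ q A P c d, v = check q A P c d

def IsClaim (v : Vertex Q Γ n) : Prop := ∃ P c q A B R, v = claim P c q A B R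

def IsWin (j : Fin 2) (v : Vertex Q Γ n) : Prop := ∃ q, v = win j q

end Vertex

/-- The edges of the finite game in which Player `i` makes the predictions. -/
inductive FiniteEdge (S : PDS Q Γ) (col : Q → Fin n) (i : Fin 2) :
    Vertex Q Γ n → Vertex Q Γ n → Prop
  | skip (q A p B P c d) (h : ⟨q, A, p, [B]⟩ ∈ S.trans) :
      FiniteEdge S col i (.check q A P c d) (.check p B P (min c (col p)) (col p))
  | push (q A p B C P c d) (h : ⟨q, A, p, [B, C]⟩ ∈ S.trans) :
      FiniteEdge S col i (.check q A P c d) (.push P c p B C)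
  | predict (P c p B C R) :
      FiniteEdge S col i (.push P c p B C) (.claim P c p B C R)
  | verify (P c p B C R) :
      FiniteEdge S col i (.claim P c p B C R) (.check p B R (col p) (col p))
  | believe (P c p B C) (R : Pred Q n) (q e) (h : q ∈ R e) :
      FiniteEdge S col i (.claim P c p B C R) (.jump q C P c e)
  | land (q C P c e) :
      FiniteEdge S col i (.jump q C P c e)
        (.check q C P (min (min c e) (col q)) (min e (col q)))
  | popCorrect (q A p) (P : Pred Q n) (c d) (h : ⟨q, A, p, []⟩ ∈ S.trans) (hp : p ∈ P c) :
      FiniteEdge S col i (.check q A P c d) (.win i p)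
  | popWrong (q A p) (P : Pred Q n) (c d) (h : ⟨q, A, p, []⟩ ∈ S.trans) (hp : p ∉ P c) :
      FiniteEdge S col i (.check q A P c d) (.win (1 - i) p)
  | sink (j q) : FiniteEdge S col i (.win j q) (.win j q)

/-- Walukiewicz's finite parity game `𝒢'_i` with colours `[n + 1]`, in which Player `i` makes the
predictions. Auxiliary vertices have the additional maximal colour `n`. -/
def finiteGame (S : PDS Q Γ) (owner : Q → Fin 2) (col : Q → Fin n) (i : Fin 2) :
    ParityGame (Vertex Q Γ n) (n + 1) where
  owner v :=
    match v with
    | .check q _ _ _ _ => owner q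
    | .push _ _ _ _ _ => i
    | _ => 1 - i
  edge := FiniteEdge S col i
  init := .check S.init ⊥ (fun _ => ∅) (col S.init) (col S.init)
  exists_edge v := by
    cases v with
    | check q A P c d =>
      obtain ⟨p, α, h⟩ := S.deadlockFree q A
      have hl : α.length ≤ 2 := (S.legal _ h).1
      match α, h, hl with
      | [], h, _ =>
        by_cases hp : p ∈ P c
        · exact ⟨_, .popCorrect _ _ _ _ _ _ h hp⟩
        · exact ⟨_, .popWrong _ _ _ _ _ _ h hp⟩
      | [B], h, _ => exact ⟨_, .skip _ _ _ _ _ _ _ h⟩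
      | [B, C], h, _ => exact ⟨_, .push _ _ _ _ _ _ _ _ h⟩
    | push P c q A B => exact ⟨_, .predict _ _ _ _ _ (fun _ => ∅)⟩
    | claim P c q A B R => exact ⟨_, .verify _ _ _ _ _ _⟩
    | jump q A P c d => exact ⟨_, .land _ _ _ _ _⟩
    | win j q => exact ⟨_, .sink _ _⟩
  col v :=
    match v with
    | .check _ _ _ _ d => d.castSucc
    | .win j q => ⟨j.val, by have := (col q).isLt; omega⟩
    | _ => Fin.last n

/-! ### The pushdown transducer built from a strategy of the predicting player -/

variable (S : PDS Q Γ) {owner : Q → Fin 2} {col : Q → Fin n} {i : Fin 2}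

/-- The transition of the pushdown system that labels an edge of the finite game; `none` is `ε`. -/
def label (i : Fin 2) : Vertex Q Γ n → Vertex Q Γ n → Option (Transition Q Γ)
  | .check q A _ _ _, .check p B _ _ _ => some ⟨q, A, p, [B]⟩
  | .check q A _ _ _, .push _ _ p B C => some ⟨q, A, p, [B, C]⟩
  | .check q A _ _ _, .win j p => if j = i then some ⟨q, A, p, []⟩ else none
  | _, _ => none

variable {S} (σ : (finiteGame S owner col i).Strategy i)

/-- The states of the transducer: the vertices visited by `σ`. -/
abbrev TState := {v : Vertex Q Γ n // σ.Visits v}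

/-- The stack symbols of the transducer: the `Claim`-vertices visited by `σ`. -/
abbrev TSymbol := {v : Vertex Q Γ n // σ.Visits v ∧ v.IsClaim}

/-- The transitions of the transducer. -/
inductive TTrans : TState σ → WithBot (TSymbol σ) → Option S.trans → TState σ →
    List (WithBot (TSymbol σ)) → Prop
  | keep (v v' : TState σ) (Z : WithBot (TSymbol σ)) (a : Option S.trans)
      (he : σ.VisitsEdge v.1 v'.1) (hv : ¬ v.1.IsClaim) (hv' : ¬ v'.1.IsWin i)
      (ha : a.map Subtype.val = label i v.1 v'.1) :
      TTrans v Z a v' [Z]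
  | store (v v' : TState σ) (Z : WithBot (TSymbol σ)) (a : Option S.trans)
      (he : σ.VisitsEdge v.1 v'.1) (hv : v.1.IsClaim) (hv' : v'.1.IsCheck)
      (ha : a.map Subtype.val = label i v.1 v'.1) :
      TTrans v Z a v' [((⟨v.1, v.2, hv⟩ : TSymbol σ) : WithBot (TSymbol σ)), Z]
  | restore (v v' : TState σ) (Z : TSymbol σ) (a : Option S.trans) (q A P c d p R e q' B C R')
      (hv : v.1 = .check q A P c d) (he : σ.VisitsEdge v.1 (.win i p))
      (ha : a.map Subtype.val = label i v.1 (.win i p))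
      (hZ : Z.1 = .claim R e q' B C R') (hv' : v'.1 = .jump p C R e c) :
      TTrans v (Z : WithBot (TSymbol σ)) a v' []

open Classical in
/-- The pushdown transducer built from `σ`. At a visited `Check`-vertex of Player `i` it outputs the
label of the edge chosen by `σ`. -/
noncomputable def transducer : PDT (TState σ) (TSymbol σ) S.trans S.trans where
  init := ⟨(finiteGame S owner col i).init, [(finiteGame S owner col i).init],
    ⟨rfl, by simp⟩, fun u v v' _ h => by
      have := h.length_le
      simp at this, by simp⟩
  trans := TTrans σ
  legal := by
    intro v Z a v' α h
    cases h with
    | keep _ _ _ _ _ _ _ =>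
      refine ⟨by simp, fun h => ⟨[], by simp [h]⟩, fun h => ?_⟩
      obtain ⟨Y, rfl⟩ := WithBot.ne_bot_iff_exists.mp h
      exact ⟨[Y], rfl⟩
    | store _ _ _ _ hv _ _ =>
      refine ⟨by simp, fun h => ⟨[⟨v.1, v.2, hv⟩], by simp [h]⟩, fun h => ?_⟩
      obtain ⟨Y, rfl⟩ := WithBot.ne_bot_iff_exists.mp h
      exact ⟨[⟨v.1, v.2, hv⟩, Y], rfl⟩
    | restore =>
      exact ⟨by simp, fun h => absurd h WithBot.coe_ne_bot, fun _ => ⟨[], rfl⟩⟩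
  out v :=
    if h : ∃ δ : S.trans, v.1.IsCheck ∧ (finiteGame S owner col i).owner v.1 = i ∧
        ∃ v', σ.VisitsEdge v.1 v' ∧ label i v.1 v' = some δ.1 then
      some h.choose
    else none

end Walukiewicz

end PushdownScores

namespace PushdownScores

open Filter

/-! ### Positional strategies -/

namespace ParityGame

variable {V : Type*} {n : ℕ} {G : ParityGame V n}

/-! The play prefix `w'` is read off from a run of the transducer on the transitions inducing `w`,
except that every completed bump of `w` is cut out. While a pushed symbol is still on the stack,
`w'` follows the verification branch `Claim` → `Check`. Once the symbol is popped, that branch is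
discarded: `w'` returns to the `Check`-vertex from before the push and takes `Push`, `Claim`,
`Jump`, `Check` instead. The prefix of `w` before the push is then exactly `Reset(w)`, and the new
`Check`-vertex carries the least colour of `lastBump(w)`. The auxiliary vertices have the maximal
colour and leave all scores alone, so appending one `Check`-vertex changes `score` by the same rule
as appending one bump changes `stairScore` (`Track.bump`).

To undo a branch, the equality of scores must be remembered for every prefix at which a claim is
still pending; `Sim` records this as a stack parallel to that of the transducer. `Aux.of_reads`
shows that every run keeps the invariant, so determinism of the transducer plays no role.

It remains that a consistent `w` has a run ending in a `Check`-vertex (`exists_run`). A winning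
strategy never visits `Win_{1-i}`, so every pop lands in a predicted state. The matching
`Jump`-vertex is then a legal choice of the opponent at the stored claim, hence visited, and the pop
can be simulated. -/

theorem IsPlayPrefix.of_prefix {w u : List V} (hw : G.IsPlayPrefix w) (h : u <+: w)
    (hu : u ≠ []) : G.IsPlayPrefix u := by
  refine ⟨?_, hw.2.prefix h⟩
  obtain ⟨t, rfl⟩ := h
  obtain ⟨a, u, rfl⟩ := List.exists_cons_of_ne_nil hu
  simpa using hw.1

theorem IsPlayPrefix.snoc {w : List V} {v v' : V} (hw : G.IsPlayPrefix w)
    (hv : w.getLast? = some v) (he : G.edge v v') : G.IsPlayPrefix (w ++ [v']) := by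
  obtain ⟨u, rfl⟩ := List.getLast?_eq_some_iff.mp hv
  refine ⟨by simpa using hw.1, ?_⟩
  rw [List.isChain_append]
  refine ⟨hw.2, by simp, ?_⟩
  simpa using he

theorem isPlayPrefix_singleton : G.IsPlayPrefix [G.init] := ⟨rfl, by simp⟩

namespace Strategy

variable {i : Fin 2} {σ : G.Strategy i}

theorem Consistent.of_prefix {w u : List V} (hw : σ.Consistent w) (h : u <+: w) :
    σ.Consistent u :=
  fun _ _ _ ho hp => hw _ _ _ ho (hp.trans h)

theorem consistent_singleton (v : V) : σ.Consistent [v] := fun u a b _ h => by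
  have := h.length_le
  simp at this

variable (σ) in
/-- The move from `v` to `v'` is allowed by the positional strategy `σ`. -/
def Move (v v' : V) : Prop :=
  G.edge v v' ∧ ∀ h : G.owner v = i, v' = σ.move [] ⟨v, h⟩

variable (σ) in
/-- The word `w` is a consistent play prefix that ends in `v`. -/
def Reach (w : List V) (v : V) : Prop :=
  G.IsPlayPrefix w ∧ σ.Consistent w ∧ w.getLast? = some v

theorem Reach.snoc (hpos : σ.Positional) {w : List V} {v v' : V} (hw : σ.Reach w v)
    (h : σ.Move v v') : σ.Reach (w ++ [v']) v' := by
  refine ⟨hw.1.snoc hw.2.2 h.1, ?_, by simp⟩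
  intro u a b ho hp
  rcases List.prefix_concat_iff.mp hp with he | hp
  · have he' : (u ++ [a]) ++ [b] = w ++ [v'] := by simpa using he
    obtain ⟨h1, h2⟩ := List.append_inj' he' rfl
    obtain rfl : b = v' := by simpa using h2
    obtain rfl : v = a := by
      have := hw.2.2
      rw [← h1] at this
      simpa using this.symm
    rw [h.2 ho]
    exact hpos _ _ _
  · exact hw.2.1 _ _ _ ho hp

theorem visits_iff_exists_reach {v : V} : σ.Visits v ↔ ∃ w, σ.Reach w v := by
  constructor
  · rintro ⟨w, h1, h2, hv⟩
    obtain ⟨a, b, rfl⟩ := List.append_of_mem hv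
    have hp : a ++ [v] <+: a ++ v :: b := ⟨b, by simp⟩
    exact ⟨_, h1.of_prefix hp (by simp), h2.of_prefix hp, by simp⟩
  · rintro ⟨w, h1, h2, h3⟩
    exact ⟨w, h1, h2, List.mem_of_getLast? h3⟩

theorem Reach.visits {w : List V} {v : V} (h : σ.Reach w v) : σ.Visits v :=
  visits_iff_exists_reach.mpr ⟨w, h⟩

/-- For a positional strategy, allowed moves from visited vertices are the same as visited edges, so
the history-dependent sets defining the transducer can be handled through `Move`, one edge at a
time. -/
theorem Visits.visitsEdge (hpos : σ.Positional) {v v' : V} (hv : σ.Visits v)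
    (h : σ.Move v v') : σ.VisitsEdge v v' := by
  obtain ⟨w, hw⟩ := visits_iff_exists_reach.mp hv
  have := hw.snoc hpos h
  refine ⟨_, this.1, this.2.1, ?_⟩
  obtain ⟨u, rfl⟩ := List.getLast?_eq_some_iff.mp hw.2.2
  exact ⟨u, [], by simp⟩

theorem VisitsEdge.move (hpos : σ.Positional) {v v' : V} (h : σ.VisitsEdge v v') :
    σ.Move v v' := by
  obtain ⟨w, h1, h2, h3⟩ := h
  refine ⟨by simpa using h1.2.infix h3, fun ho => ?_⟩
  obtain ⟨a, b, rfl⟩ := h3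
  rw [h2 a v v' ho ⟨b, rfl⟩]
  exact hpos _ _ _

theorem VisitsEdge.visits_right {v v' : V} (h : σ.VisitsEdge v v') : σ.Visits v' := by
  obtain ⟨w, h1, h2, h3⟩ := h
  exact ⟨w, h1, h2, h3.subset (by simp)⟩

theorem Visits.of_move (hpos : σ.Positional) {v v' : V} (hv : σ.Visits v)
    (h : σ.Move v v') : σ.Visits v' :=
  (hv.visitsEdge hpos h).visits_right

variable (σ) in
theorem move_of_owner_ne {v v' : V} (ho : G.owner v ≠ i) (he : G.edge v v') : σ.Move v v' :=
  ⟨he, fun h => absurd h ho⟩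

variable (σ) in
theorem move_move {v : V} (ho : G.owner v = i) : σ.Move v (σ.move [] ⟨v, ho⟩) :=
  ⟨σ.legal [] ⟨v, ho⟩, fun _ => rfl⟩

theorem exists_move (v : V) : ∃ v', σ.Move v v' := by
  by_cases h : G.owner v = i
  · exact ⟨_, σ.move_move h⟩
  · obtain ⟨v', h'⟩ := G.exists_edge v
    exact ⟨v', σ.move_of_owner_ne h h'⟩

/-- A winning strategy does not reach a sink whose colour has the wrong parity. -/
theorem Winning.not_visits_sink (hwin : σ.Winning) {v : V} (ho : G.owner v ≠ i)
    (he : G.edge v v) (hc : (G.col v).val % 2 ≠ i.val) : ¬ σ.Visits v := by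
  intro hv
  obtain ⟨w, hw⟩ := visits_iff_exists_reach.mp hv
  obtain ⟨u, rfl⟩ := List.getLast?_eq_some_iff.mp hw.2.2
  -- The default value `v` of `getD` prolongs the finite play by looping in the sink forever.
  set ρ : ℕ → V := fun m => (u ++ [v]).getD m v with hρ
  have htail : ∀ m, u.length ≤ m → ρ m = v := by
    intro m hm
    simp only [hρ, List.getD_eq_getElem?_getD, List.getElem?_append_right hm]
    rcases hk : m - u.length with _ | k <;> simp
  have hmap : ∀ m, m ≤ u.length + 1 → (List.range m).map ρ = (u ++ [v]).take m := by
    intro m hm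
    refine List.ext_getElem (by simpa using hm) fun k h1 h2 => ?_
    simp only [List.length_take] at h2
    simp only [List.getElem_map, List.getElem_range, List.getElem_take, hρ]
    rw [List.getD_eq_getElem]
  have hpre : ∀ m, m + 1 ≤ u.length →
      (List.range m).map ρ ++ [ρ m, ρ (m + 1)] <+: u ++ [v] := by
    intro m hm
    have : (List.range m).map ρ ++ [ρ m, ρ (m + 1)] = (List.range (m + 2)).map ρ := by
      simp [List.range_succ]
    rw [this, hmap _ (by omega)]
    exact List.take_prefix _ _
  have hplay : G.IsPlay ρ := by
    constructor
    · have := hw.1.1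
      rw [List.head?_eq_getElem?] at this
      simp only [hρ, List.getD_eq_getElem?_getD, this, Option.getD_some]
    · intro m
      rcases Nat.lt_or_ge m u.length with hm | hm
      · have hinf : [ρ m, ρ (m + 1)] <:+: u ++ [v] :=
          (List.suffix_append _ _).isInfix.trans (hpre m hm).isInfix
        simpa using hw.1.2.infix hinf
      · rw [htail m hm, htail _ (by omega)]
        exact he
  have hcon : σ.ConsistentPlay ρ := by
    intro m hm
    rcases Nat.lt_or_ge m u.length with hlt | hge
    · exact hw.2.1 _ _ _ hm (hpre m hlt)
    · exact absurd (htail m hge ▸ hm) ho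
  -- A colour seen infinitely often is seen on the constant tail, so it is the colour of the sink.
  obtain ⟨c, hcl, hcp⟩ := hwin ρ hplay hcon
  have hfr : ∃ᶠ m in atTop, G.col (ρ m) = c := hcl.1
  obtain ⟨m, hm, hmc⟩ := (frequently_atTop.mp hfr) u.length
  rw [htail m hm] at hmc
  exact hc (hmc ▸ hcp)

end Strategy

end ParityGame

/-! ### Scores -/

section Scores

variable {V : Type*} {n : ℕ}

theorem score_concat (col : V → Fin n) (c : Fin n) (w : List V) (v : V) :
    score col c (w ++ [v]) =
      if c < col v then score col c w else if col v = c then score col c w + 1 else 0 := by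
  simp [score]

/-- `m` is the minimal colour occurring in `t`. -/
def IsMinCol (col : V → Fin n) (t : List V) (m : Fin n) : Prop :=
  IsLeast (col '' {z | z ∈ t}) m

theorem IsMinCol.append {col : V → Fin n} {t t' : List V} {m m' : Fin n}
    (h : IsMinCol col t m) (h' : IsMinCol col t' m') : IsMinCol col (t ++ t') (min m m') := by
  have := IsLeast.union h h'
  rw [← Set.image_union] at this
  simpa [IsMinCol, Set.union_def] using this

theorem isMinCol_singleton (col : V → Fin n) (v : V) : IsMinCol col [v] (col v) := by
  simp [IsMinCol]

theorem IsMinCol.minCol_eq {col : V → Fin n} {t : List V} {m : Fin n} (h : IsMinCol col t m)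
    (ht : t ≠ []) : minCol col t ht = m := by
  refine IsLeast.unique ⟨?_, ?_⟩ h
  · obtain ⟨z, hz, he⟩ := List.mem_map.mp (List.min_mem (l := t.map col) (by simpa using ht))
    exact ⟨z, hz, he⟩
  · rintro _ ⟨z, hz, rfl⟩
    exact List.min_le_of_mem (List.mem_map_of_mem hz)

/-- Everything in `t` is strictly higher than `y`, while the last letter `x` of `u` is not, so the
backward search for the last stair stops at `x`. -/
theorem reset_append {sh : V → ℕ} {u t : List V} {x y : V} (hu : u.getLast? = some x)
    (ht : ∀ z ∈ t, sh y < sh z) (hxy : sh x ≤ sh y) (hne : u ++ (t ++ [y]) ≠ []) :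
    reset sh (u ++ (t ++ [y])) hne = u := by
  obtain ⟨u, rfl⟩ := List.getLast?_eq_some_iff.mp hu
  have h1 : (u ++ [x] ++ (t ++ [y])).getLast hne = y := by simp
  have h2 : (u ++ [x] ++ (t ++ [y])).dropLast = u ++ [x] ++ t := by
    rw [← List.append_assoc, List.dropLast_concat]
  unfold reset
  rw [h1, h2, List.rdropWhile, List.reverse_append, List.dropWhile_append_of_pos]
  · simp [hxy]
  · simpa using ht

/-- This is `score_concat` with a whole bump in the place of one letter and its least colour `m` in
the place of the colour of that letter; the simulation rests on this match. -/
theorem stairScore_append {sh : V → ℕ} {col : V → Fin n} {u t : List V} {x y : V} {m : Fin n}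
    (c : Fin n) (hu : u.getLast? = some x) (ht : ∀ z ∈ t, sh y < sh z) (hxy : sh x ≤ sh y)
    (hm : IsMinCol col (t ++ [y]) m) :
    stairScore sh col c (u ++ (t ++ [y])) =
      if c < m then stairScore sh col c u
      else if m = c then stairScore sh col c u + 1 else 0 := by
  have hne : u ++ (t ++ [y]) ≠ [] := by simp
  have h1 := reset_append hu ht hxy hne
  have h2 : lastBump sh (u ++ (t ++ [y])) hne = t ++ [y] := by
    have := reset_append_lastBump sh _ hne
    rw [h1] at this
    exact List.append_cancel_left this
  have h3 : minCol col (lastBump sh (u ++ (t ++ [y])) hne) (lastBump_ne_nil _ _ _) = m := by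
    apply IsMinCol.minCol_eq
    rwa [h2]
  rw [stairScore, dif_neg hne, h1, h3]

theorem stairScore_singleton (sh : V → ℕ) (col : V → Fin n) (c : Fin n) (v : V) :
    stairScore sh col c [v] = if c < col v then 0 else if col v = c then 1 else 0 := by
  have h1 : reset sh [v] (by simp) = [] := by simp [reset]
  have h2 : lastBump sh [v] (by simp) = [v] := by simp [lastBump]
  have h3 : minCol col (lastBump sh [v] (by simp)) (lastBump_ne_nil _ _ _) = col v := by
    apply IsMinCol.minCol_eq
    rw [h2]
    exact isMinCol_singleton _ _
  have h0 : stairScore sh col c [] = 0 := by rw [stairScore]; simp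
  rw [stairScore, dif_neg (by simp), h1, h3, h0]

end Scores

/-! ### Configurations and runs -/

section Pushdown

variable {Q Γ : Type*}

namespace Config

theorem content_ne_nil (v : Config Q Γ) : v.content ≠ [] := by simp [content]

theorem content_eq_map (v : Config Q Γ) : v.content = v.stack.map WithBot.some ++ [⊥] := by
  simp only [content, List.append_cancel_right_eq]
  induction v.stack with
  | nil => rfl
  | cons a l ih => exact congrArg _ ih

theorem content_eq (v : Config Q Γ) : v.content = v.top :: v.content.tail := by
  exact (List.cons_head_tail v.content_ne_nil).symm

theorem sh_of_content {v : Config Q Γ} {A : WithBot Γ} {X : List (WithBot Γ)}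
    (h : v.content = A :: X) : v.sh = X.length := by
  simp [sh, h]

theorem content_injective {v v' : Config Q Γ} (h : v.content = v'.content) :
    v.stack = v'.stack := by
  rw [content_eq_map, content_eq_map] at h
  exact List.map_injective_iff.mpr WithBot.coe_injective (List.append_cancel_right h)

end Config

theorem Induces.nil {S : PDS Q Γ} {w : List (Config Q Γ)} (h : Induces S w []) :
    ∃ v, w = [v] := by
  generalize hd : ([] : List S.trans) = d at h
  cases h with
  | single v => exact ⟨v, rfl⟩
  | snoc => simp at hd

theorem Induces.snoc_inv {S : PDS Q Γ} {w : List (Config Q Γ)} {d : List S.trans} {δ : S.trans}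
    (h : Induces S w (d ++ [δ])) :
    ∃ u v v', w = u ++ [v, v'] ∧ Induces S (u ++ [v]) d ∧ Config.Fires δ.1 v v' := by
  generalize hd : d ++ [δ] = d' at h
  cases h with
  | single v => simp at hd
  | snoc u v v' d₁ δ₁ h1 h2 =>
    obtain ⟨rfl, h⟩ := List.append_inj' hd rfl
    obtain rfl : δ = δ₁ := by simpa using h
    exact ⟨u, v, v', rfl, h1, h2⟩

/-- The written word is recovered by cancelling the untouched part of the stack, so the two
configurations determine the transition. -/
theorem Config.Fires.unique {δ δ' : Transition Q Γ} {v v' : Config Q Γ} (h : Config.Fires δ v v')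
    (h' : Config.Fires δ' v v') : δ = δ' := by
  obtain ⟨a1, a2, a3, a4⟩ := h
  obtain ⟨b1, b2, b3, b4⟩ := h'
  exact Transition.ext (a1.symm.trans b1) (a2.symm.trans b2) (a3.symm.trans b3)
    (List.append_cancel_right (a4.symm.trans b4))

/-- A path is induced by at most one sequence of transitions. -/
theorem Induces.unique {S : PDS Q Γ} {w : List (Config Q Γ)} {d d' : List S.trans}
    (h : Induces S w d) (h' : Induces S w d') : d = d' := by
  induction h generalizing d' with
  | single v =>
    rcases List.eq_nil_or_concat' d' with rfl | ⟨e, δ, rfl⟩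
    · rfl
    · obtain ⟨u, a, b, he, -⟩ := h'.snoc_inv
      have := congrArg List.length he
      simp at this
  | snoc u v v' d δ h1 h2 ih =>
    rcases List.eq_nil_or_concat' d' with rfl | ⟨e, δ', rfl⟩
    · obtain ⟨a, he⟩ := h'.nil
      have := congrArg List.length he
      simp at this
    · obtain ⟨u', a, b, he, h3, h4⟩ := h'.snoc_inv
      obtain ⟨rfl, h5⟩ := List.append_inj' he rfl
      simp only [List.cons.injEq, and_true] at h5
      obtain ⟨rfl, rfl⟩ := h5
      rw [ih h3, Subtype.ext (h2.unique h4)]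

end Pushdown

/-! ### The simulation invariant -/

section Simulation

variable {Q Γ : Type*} {n : ℕ} {S : PDS Q Γ} {owner : Q → Fin 2} {col : Q → Fin n} {i : Fin 2}

theorem one_sub_ne (i : Fin 2) : 1 - i ≠ i := by
  decide +revert

theorem one_sub_val_mod_ne (i : Fin 2) : (1 - i).val % 2 ≠ i.val := by
  decide +revert

theorem Vertex.not_visits_win {σ : (finiteGame S owner col i).Strategy i} (hwin : σ.Winning)
    (q : Q) : ¬ σ.Visits (.win (1 - i) q) := by
  refine hwin.not_visits_sink (one_sub_ne i) (.sink _ _) ?_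
  exact one_sub_val_mod_ne i

variable (σ : (finiteGame S owner col i).Strategy i)

/-- The stair-scores of `w` are the scores of a consistent play prefix that ends in `v`. -/
def Track (w : List (Config Q Γ)) (v : Vertex Q Γ n) : Prop :=
  ∃ w', σ.Reach w' v ∧ ∀ c : Fin n,
    stairScore Config.sh (pushdownGame S owner col).col c w =
      score (finiteGame S owner col i).col c.castSucc w'

/-- The path `w` leads to the `Check`-vertex `v` with the stack `s` of pending claims. -/
inductive Sim : List (Config Q Γ) → Vertex Q Γ n → List (TSymbol σ) → Prop
  | base {w y q P c d} (hl : w.getLast? = some y) (hy : y = ⟨q, []⟩)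
      (ht : Track σ w (.check q ⊥ P c d)) : Sim w (.check q ⊥ P c d) []
  -- `u` ends just before the pending push and `t` is the part after it. `X` is the stack below the
  -- symbol `A₀` that was replaced, so `x` has height `X.length` and `t` stays strictly above. `c`
  -- is the least colour of `t`, which is what a later pop compares with the prediction `P`.
  | level {u t x y s} {Z : TSymbol σ} {q₀ A₀ R e d₀ p B C P q A c d} {X : List (WithBot Γ)}
      (hS : Sim u (.check q₀ A₀ R e d₀) s) (hx : u.getLast? = some x) (hxc : x.content = A₀ :: X)
      (h1 : σ.Move (.check q₀ A₀ R e d₀) (.push R e p B C))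
      (h2 : σ.Move (.push R e p B C) (.claim R e p B C P)) (hZ : Z.1 = .claim R e p B C P)
      (hy : (u ++ t).getLast? = some y) (hyc : y.content = A :: C :: X) (hq : y.state = q)
      (hh : ∀ z ∈ t, X.length < z.sh) (hm : IsMinCol (pushdownGame S owner col).col t c)
      (ht : Track σ (u ++ t) (.check q A P c d)) : Sim (u ++ t) (.check q A P c d) (Z :: s)

/-- The path `w` leads to the vertex `v` with the stack `s` of pending claims, where the vertices
between two `Check`-vertices are included. -/
inductive Aux : List (Config Q Γ) → Vertex Q Γ n → List (TSymbol σ) → Prop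
  | check {w q A P c d s} (h : Sim σ w (.check q A P c d) s) : Aux w (.check q A P c d) s
  -- At auxiliary vertices the colour of the newest configuration `y` has not yet been seen in the
  -- finite game, so the scores need not agree there. The invariant is kept for `u` only; the next
  -- `Check`-vertex accounts for `y`.
  | push {u x y s q A P c d p B C} {X : List (WithBot Γ)}
      (hS : Sim σ u (.check q A P c d) s) (hx : u.getLast? = some x) (hxc : x.content = A :: X)
      (h1 : σ.Move (.check q A P c d) (.push P c p B C))
      (hyc : y.content = B :: C :: X) (hy : y.state = p) : Aux (u ++ [y]) (.push P c p B C) s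
  | claim {u x y s q A P c d p B C R} {X : List (WithBot Γ)}
      (hS : Sim σ u (.check q A P c d) s) (hx : u.getLast? = some x) (hxc : x.content = A :: X)
      (h1 : σ.Move (.check q A P c d) (.push P c p B C))
      (h2 : σ.Move (.push P c p B C) (.claim P c p B C R))
      (hyc : y.content = B :: C :: X) (hy : y.state = p) : Aux (u ++ [y]) (.claim P c p B C R) s
  | jump {u t x y s q A P c d p B C R q' e} {X : List (WithBot Γ)}
      (hS : Sim σ u (.check q A P c d) s) (hx : u.getLast? = some x) (hxc : x.content = A :: X)
      (h1 : σ.Move (.check q A P c d) (.push P c p B C))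
      (h2 : σ.Move (.push P c p B C) (.claim P c p B C R))
      (h3 : σ.Move (.claim P c p B C R) (.jump q' C P c e))
      (hh : ∀ z ∈ t, X.length < z.sh) (hm : IsMinCol (pushdownGame S owner col).col t e)
      (hyc : y.content = C :: X) (hy : y.state = q') :
      Aux (u ++ (t ++ [y])) (.jump q' C P c e) s

variable {σ}

theorem Track.silent (hpos : σ.Positional) {w : List (Config Q Γ)} {v v' : Vertex Q Γ n}
    (h : Track σ w v) (hm : σ.Move v v') (hc : (finiteGame S owner col i).col v' = Fin.last n) :
    Track σ w v' := by
  obtain ⟨w', hr, hs⟩ := h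
  refine ⟨w' ++ [v'], hr.snoc hpos hm, fun c => ?_⟩
  rw [score_concat, if_pos (hc ▸ Fin.castSucc_lt_last c), hs]

theorem Track.bump (hpos : σ.Positional) {u t : List (Config Q Γ)} {x y : Config Q Γ}
    {v v' : Vertex Q Γ n} {m : Fin n} (h : Track σ u v) (hm : σ.Move v v')
    (hc : (finiteGame S owner col i).col v' = m.castSucc) (hx : u.getLast? = some x)
    (ht : ∀ z ∈ t, y.sh < z.sh) (hxy : x.sh ≤ y.sh)
    (hmin : IsMinCol (pushdownGame S owner col).col (t ++ [y]) m) :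
    Track σ (u ++ (t ++ [y])) v' := by
  obtain ⟨w', hr, hs⟩ := h
  refine ⟨w' ++ [v'], hr.snoc hpos hm, fun c => ?_⟩
  rw [score_concat, stairScore_append c hx ht hxy hmin, hc, hs]
  simp only [Fin.castSucc_lt_castSucc_iff, Fin.castSucc_inj]

theorem Track.visits {w : List (Config Q Γ)} {v : Vertex Q Γ n} (h : Track σ w v) :
    σ.Visits v := by
  obtain ⟨w', hr, -⟩ := h
  exact hr.visits

theorem Sim.track {w : List (Config Q Γ)} {v : Vertex Q Γ n} {s : List (TSymbol σ)}
    (h : Sim σ w v s) : Track σ w v := by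
  cases h <;> assumption

theorem Sim.last {w : List (Config Q Γ)} {q : Q} {A : WithBot Γ} {P : Pred Q n} {c d : Fin n}
    {s : List (TSymbol σ)} (h : Sim σ w (.check q A P c d) s) :
    ∃ x X, w.getLast? = some x ∧ x.state = q ∧ x.content = A :: X := by
  cases h with
  | base hl hy ht => subst hy; exact ⟨_, [], hl, rfl, rfl⟩
  | level hS hx hxc h1 h2 hZ hy hyc hq hh hm ht => exact ⟨_, _, hy, hq, hyc⟩

theorem Aux.sim {w : List (Config Q Γ)} {q : Q} {A : WithBot Γ} {P : Pred Q n} {c d : Fin n}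
    {s : List (TSymbol σ)} (h : Aux σ w (.check q A P c d) s) : Sim σ w (.check q A P c d) s := by
  cases h
  assumption

/-- The non-strict bound `X.length ≤ z.sh` suffices: at a pending claim `X` has the form `C :: X₀`,
so `t` stays strictly above `X₀`. Without pending claims no height condition is recorded at all. -/
theorem Sim.extend {w t : List (Config Q Γ)} {x y : Config Q Γ} {q p : Q} {A B : WithBot Γ}
    {P : Pred Q n} {c d m d' : Fin n} {s : List (TSymbol σ)} {X : List (WithBot Γ)}
    (h : Sim σ w (.check q A P c d) s) (hx : w.getLast? = some x) (hxc : x.content = A :: X)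
    (ht : ∀ z ∈ t, X.length ≤ z.sh) (hm : IsMinCol (pushdownGame S owner col).col t m)
    (hy : t.getLast? = some y) (hyc : y.content = B :: X) (hp : y.state = p)
    (htr : Track σ (w ++ t) (.check p B P (min c m) d')) :
    Sim σ (w ++ t) (.check p B P (min c m) d') s := by
  have hlast : (w ++ t).getLast? = some y := by
    obtain ⟨t, rfl⟩ := List.getLast?_eq_some_iff.mp hy
    rw [← List.append_assoc, List.getLast?_concat]
  cases h with
  | base hl hx' _ =>
    obtain rfl : _ = x := Option.some.inj (hl.symm.trans hx)
    subst hx'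
    obtain rfl : [] = X := by simpa [Config.content] using hxc
    obtain ⟨p', γ⟩ := y
    have hlen := congrArg List.length hyc
    obtain rfl : γ = [] := by
      rw [Config.content_eq_map] at hlen
      simpa using hlen
    obtain rfl : ⊥ = B := by simpa [Config.content] using hyc
    obtain rfl : p' = p := hp
    exact .base hlast rfl htr
  | level hS hx₀ hxc₀ h1 h2 hZ hy₀ hyc₀ hq₀ hh hm₀ _ =>
    obtain rfl : _ = x := Option.some.inj (hy₀.symm.trans hx)
    obtain ⟨-, rfl⟩ := List.cons_eq_cons.mp (hyc₀.symm.trans hxc)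
    rw [List.append_assoc] at hlast htr ⊢
    refine .level hS hx₀ hxc₀ h1 h2 hZ hlast hyc hp ?_ (hm₀.append hm) htr
    intro z hz
    rcases List.mem_append.mp hz with hz | hz
    · exact hh z hz
    · exact ht z hz

/-! ### Steps of the transducer preserve the invariant -/

theorem Aux.skip (hpos : σ.Positional) {w : List (Config Q Γ)} {x y : Config Q Γ} {q p : Q}
    {A B : WithBot Γ} {P : Pred Q n} {c d : Fin n} {s : List (TSymbol σ)}
    {X : List (WithBot Γ)} (h : Sim σ w (.check q A P c d) s) (hx : w.getLast? = some x)
    (hxc : x.content = A :: X) (hyc : y.content = B :: X) (hp : y.state = p)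
    (hm : σ.Move (.check q A P c d) (.check p B P (min c (col p)) (col p))) :
    Aux σ (w ++ [y]) (.check p B P (min c (col p)) (col p)) s := by
  subst hp
  have hmin := isMinCol_singleton (pushdownGame S owner col).col y
  have hsh := Config.sh_of_content hyc
  refine .check (h.extend hx hxc (by simp [hsh]) hmin rfl hyc rfl ?_)
  exact h.track.bump hpos (t := []) hm rfl hx (by simp)
    (by rw [hsh, Config.sh_of_content hxc]) hmin

theorem Aux.verify (hpos : σ.Positional) {w : List (Config Q Γ)} {P R : Pred Q n} {c : Fin n}
    {p : Q} {B C : WithBot Γ} {s : List (TSymbol σ)} {Z : TSymbol σ}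
    (h : Aux σ w (.claim P c p B C R) s) (hZ : Z.1 = .claim P c p B C R)
    (h3 : σ.Move (.claim P c p B C R) (.check p B R (col p) (col p))) :
    Aux σ w (.check p B R (col p) (col p)) (Z :: s) := by
  cases h with
  | @claim _ _ y _ _ _ _ _ _ _ _ _ _ _ hS hx hxc h1 h2 hyc hy =>
    subst hy
    have hmin := isMinCol_singleton (pushdownGame S owner col).col y
    have hsh := Config.sh_of_content hyc
    refine .check (.level hS hx hxc h1 h2 hZ (by simp) hyc rfl (by simp [hsh]) hmin ?_)
    exact ((hS.track.silent hpos h1 rfl).silent hpos h2 rfl).bump hpos (t := []) h3 rfl hx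
      (by simp) (by rw [hsh, Config.sh_of_content hxc]; simp) hmin

theorem Aux.land (hpos : σ.Positional) {w : List (Config Q Γ)} {P : Pred Q n} {c e : Fin n}
    {q : Q} {C : WithBot Γ} {s : List (TSymbol σ)} (h : Aux σ w (.jump q C P c e) s)
    (h4 : σ.Move (.jump q C P c e)
      (.check q C P (min (min c e) (col q)) (min e (col q)))) :
    Aux σ w (.check q C P (min (min c e) (col q)) (min e (col q))) s := by
  cases h with
  | @jump _ _ _ y _ _ _ _ _ _ _ _ _ _ _ _ _ hS hx hxc h1 h2 h3 hh hm hyc hy =>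
    subst hy
    have hmin := hm.append (isMinCol_singleton (pushdownGame S owner col).col y)
    have hsh := Config.sh_of_content hyc
    -- Regrouping exposes `min e (col q)`, the least colour of the whole bump `t ++ [y]` and the
    -- colour of the target vertex.
    rw [min_assoc] at h4 ⊢
    refine .check (hS.extend hx hxc ?_ hmin (by simp) hyc rfl ?_)
    · intro z hz
      rcases List.mem_append.mp hz with hz | hz
      · exact (hh z hz).le
      · rw [List.mem_singleton.mp hz, hsh]
    · exact (((hS.track.silent hpos h1 rfl).silent hpos h2 rfl).silent hpos h3 rfl).bump hpos
        h4 rfl hx (by simpa [hsh] using hh) (by rw [hsh, Config.sh_of_content hxc]) hmin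

/-- The popped claim supplies the `u` and `t` of the last `level`. The verification branch over `t`
is dropped, and since `p ∈ P c` the opponent may answer that claim with the jump. -/
theorem Aux.pop {w : List (Config Q Γ)} {x y : Config Q Γ} {q p q' : Q} {A B C : WithBot Γ}
    {P R R' : Pred Q n} {c d e : Fin n} {s : List (TSymbol σ)} {Z : TSymbol σ}
    {X : List (WithBot Γ)} (h : Sim σ w (.check q A P c d) (Z :: s))
    (hZ : Z.1 = .claim R e q' B C R') (hx : w.getLast? = some x) (hxc : x.content = A :: X)
    (hyc : y.content = X) (hp : y.state = p) (hpP : p ∈ P c) :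
    Aux σ (w ++ [y]) (.jump p C R e c) s := by
  cases h with
  | level hS hx₀ hxc₀ h1 h2 hZ' hy₀ hyc₀ hq₀ hh hm₀ _ =>
    obtain ⟨rfl, rfl, -, -, rfl, -⟩ := Vertex.claim.inj (hZ'.symm.trans hZ)
    obtain rfl : _ = x := Option.some.inj (hy₀.symm.trans hx)
    obtain ⟨-, rfl⟩ := List.cons_eq_cons.mp (hyc₀.symm.trans hxc)
    rw [List.append_assoc]
    exact .jump hS hx₀ hxc₀ h1 h2 (σ.move_of_owner_ne (one_sub_ne i) (.believe _ _ _ _ _ _ _ _ hpP))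
      hh hm₀ hyc hp

/-! ### Stack contents under single transducer steps -/

theorem Config.content_singleton_step {Q' Γ' : Type*} {κ κ' : Config Q' Γ'}
    (h : κ'.content = [κ.top] ++ κ.content.tail) : κ'.stack = κ.stack :=
  Config.content_injective (h.trans κ.content_eq.symm)

theorem Config.content_cons_step {Q' Γ' : Type*} {κ κ' : Config Q' Γ'} {Z : Γ'}
    (h : κ'.content = [(Z : WithBot Γ'), κ.top] ++ κ.content.tail) :
    κ'.stack = Z :: κ.stack := by
  have h' : κ'.content = (⟨κ.state, Z :: κ.stack⟩ : Config Q' Γ').content := by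
    rw [h, List.cons_append, List.singleton_append, ← κ.content_eq]
    rfl
  exact Config.content_injective h'

theorem Config.content_tail_step {Q' Γ' : Type*} {κ κ' : Config Q' Γ'} {Z : Γ'}
    (ht : κ.top = Z) (h : κ'.content = κ.content.tail) : κ.stack = Z :: κ'.stack := by
  have h' : κ.content = (⟨κ.state, Z :: κ'.stack⟩ : Config Q' Γ').content := by
    rw [κ.content_eq, ht, ← h]
    rfl
  exact Config.content_injective h'

theorem Aux.step_none (hpos : σ.Positional) (hwin : σ.Winning) {w : List (Config Q Γ)}
    {κ κ' : Config (TState σ) (TSymbol σ)} (h : Aux σ w κ.state.1 κ.stack)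
    (hs : (transducer σ).Step κ none κ') : Aux σ w κ'.state.1 κ'.stack := by
  obtain ⟨⟨v, hv⟩, s⟩ := κ
  obtain ⟨⟨v', hv'⟩, s'⟩ := κ'
  obtain ⟨α, ht, hα⟩ := hs
  generalize hZ : Config.top (⟨⟨v, hv⟩, s⟩ : Config (TState σ) (TSymbol σ)) = Z at ht
  cases ht with
  | keep _ _ _ he hcl hw ha =>
    subst hZ
    obtain rfl := Config.content_singleton_step hα
    have hm := he.move hpos
    cases hm.1 with
    | skip => simp [label] at ha
    | push => simp [label] at ha
    | predict =>
      cases h with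
      | push hS hx hxc h1 hyc hy => exact .claim hS hx hxc h1 hm hyc hy
    | verify => exact absurd ⟨_, _, _, _, _, _, rfl⟩ hcl
    | believe => exact absurd ⟨_, _, _, _, _, _, rfl⟩ hcl
    | land => exact h.land hpos hm
    | popCorrect => exact absurd ⟨_, rfl⟩ hw
    -- A wrong pop has label `ε`, so only the winning strategy rules it out.
    | popWrong => exact absurd hv' (Vertex.not_visits_win hwin _)
    | sink => cases h
  | store _ _ _ he hcl hch ha =>
    subst hZ
    obtain rfl := Config.content_cons_step hα
    have hm := he.move hpos
    obtain ⟨_, _, _, _, _, _, hv₀⟩ := id hcl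
    have hv₀ : v = _ := hv₀
    subst hv₀
    obtain ⟨_, _, _, _, _, hv₁⟩ := id hch
    have hv₁ : v' = _ := hv₁
    subst hv₁
    cases hm.1 with
    | verify => exact h.verify hpos rfl hm
  | restore _ _ _ _ _ _ _ _ _ _ _ _ _ _ _ hv₀ _ ha =>
    have hv₀ : v = _ := hv₀
    subst hv₀
    simp [label] at ha

theorem Aux.step_some (hpos : σ.Positional) (hwin : σ.Winning) {w : List (Config Q Γ)}
    {x y : Config Q Γ} {δ : S.trans}
    {κ κ' : Config (TState σ) (TSymbol σ)} (h : Aux σ w κ.state.1 κ.stack)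
    (hx : w.getLast? = some x) (hf : Config.Fires δ.1 x y)
    (hs : (transducer σ).Step κ (some δ) κ') : Aux σ (w ++ [y]) κ'.state.1 κ'.stack := by
  obtain ⟨⟨v, hv⟩, s⟩ := κ
  obtain ⟨⟨v', hv'⟩, s'⟩ := κ'
  obtain ⟨α, ht, hα⟩ := hs
  obtain ⟨δ, hδ⟩ := δ
  obtain ⟨-, htop, htgt, hcont⟩ := hf
  have hxc := x.content_eq
  rw [htop] at hxc
  generalize hZ : Config.top (⟨⟨v, hv⟩, s⟩ : Config (TState σ) (TSymbol σ)) = Z at ht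
  cases ht with
  | keep _ _ _ he hcl hw ha =>
    subst hZ
    obtain rfl := Config.content_singleton_step hα
    have hm := he.move hpos
    cases hm.1 with
    | skip =>
      obtain rfl : δ = _ := Option.some.inj ha
      cases h with
      | check h => exact .skip hpos h hx hxc hcont htgt hm
    | push =>
      obtain rfl : δ = _ := Option.some.inj ha
      cases h with
      | check h => exact .push h hx hxc hm hcont htgt
    | predict => simp [label] at ha
    | verify => simp [label] at ha
    | believe => simp [label] at ha
    | land => simp [label] at ha
    | popCorrect => exact absurd ⟨_, rfl⟩ hw
    | popWrong => exact absurd hv' (Vertex.not_visits_win hwin _)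
    | sink => cases h
  | store _ _ _ he hcl hch ha =>
    obtain ⟨_, _, _, _, _, _, hv₀⟩ := id hcl
    have hv₀ : v = _ := hv₀
    subst hv₀
    simp [label] at ha
  | restore _ _ Z q A P c d p R e q' B C R' hv₀ he ha hZ₀ hv₁ =>
    obtain rfl := Config.content_tail_step hZ hα
    have hv₀ : v = _ := hv₀
    have hv₁ : v' = _ := hv₁
    subst hv₀ hv₁
    have ha' : some δ = some ⟨q, A, p, []⟩ := by simpa [label] using ha
    obtain rfl := Option.some.inj ha'
    have hm := he.move hpos
    cases h with
    | check h =>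
      refine .pop h hZ₀ hx hxc hcont htgt ?_
      -- The edge inversion cannot unify `i` with `1 - i` directly, so the target is abstracted and
      -- the case of a wrong pop refuted by hand.
      generalize hj : Vertex.win i p = v₁ at hm
      cases hm.1 with
      | popCorrect _ _ _ _ _ _ _ hp =>
        obtain ⟨-, rfl⟩ := Vertex.win.inj hj
        exact hp
      | popWrong => exact absurd (Vertex.win.inj hj).1.symm (one_sub_ne i)
      | _ => cases hj

theorem track_init : Track σ [(⟨S.init, []⟩ : Config Q Γ)] (finiteGame S owner col i).init := by
  refine ⟨[_], ⟨ParityGame.isPlayPrefix_singleton,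
    ParityGame.Strategy.consistent_singleton _, rfl⟩, fun c => ?_⟩
  rw [stairScore_singleton, ← List.nil_append [_], score_concat]
  change _ = if c.castSucc < (col S.init).castSucc then _
    else if (col S.init).castSucc = c.castSucc then _ else _
  simp only [Fin.castSucc_lt_castSucc_iff, Fin.castSucc_inj]
  rfl

/-- Every run of the transducer satisfies the invariant. -/
theorem Aux.of_reads (hpos : σ.Positional) (hwin : σ.Winning) {w : List (Config Q Γ)}
    {d : List S.trans} {κ : Config (TState σ) (TSymbol σ)} (hr : (transducer σ).Reads d κ)
    (hd : Induces S w d) (hw : w.head? = some ⟨S.init, []⟩) : Aux σ w κ.state.1 κ.stack := by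
  induction hr generalizing w with
  | start =>
    obtain ⟨v, rfl⟩ := hd.nil
    obtain rfl : v = ⟨S.init, []⟩ := by simpa using hw
    exact .check (.base rfl rfl track_init)
  | step d κ κ' a _ hs ih =>
    cases a with
    | none =>
      rw [Option.toList_none, List.append_nil] at hd
      exact (ih hd hw).step_none hpos hwin hs
    | some δ =>
      obtain ⟨u, v, v', rfl, hd', hf⟩ := hd.snoc_inv
      have hw' : (u ++ [v]).head? = some ⟨S.init, []⟩ := by
        cases u <;> simpa using hw
      have := (ih hd' hw').step_some hpos hwin (by simp) hf hs
      simpa using this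

end Simulation

/-! ### Runs of the transducer on consistent play prefixes -/

section Existence

variable {Q Γ : Type*} {n : ℕ} {S : PDS Q Γ} {owner : Q → Fin 2} {col : Q → Fin n} {i : Fin 2}
  {σ : (finiteGame S owner col i).Strategy i}

/-! ### Runs of the transducer following moves of the finite game -/

theorem reads_keep {d : List S.trans} {κ : Config (TState σ) (TSymbol σ)} {v v' : Vertex Q Γ n}
    {a : Option S.trans} (hr : (transducer σ).Reads d κ) (hv : κ.state.1 = v)
    (he : σ.VisitsEdge v v') (hc : ¬ v.IsClaim) (hw : ¬ v'.IsWin i)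
    (ha : a.map Subtype.val = label i v v') :
    (transducer σ).Reads (d ++ a.toList) ⟨⟨v', he.visits_right⟩, κ.stack⟩ := by
  subst hv
  exact .step _ _ _ _ hr ⟨[κ.top], .keep _ ⟨v', he.visits_right⟩ _ _ he hc hw ha, κ.content_eq⟩

theorem reads_store {d : List S.trans} {κ : Config (TState σ) (TSymbol σ)} {v v' : Vertex Q Γ n}
    (hr : (transducer σ).Reads d κ) (hv : κ.state.1 = v)
    (he : σ.VisitsEdge v v') (hc : v.IsClaim) (hch : v'.IsCheck) (ha : none = label i v v') :
    ∃ κ', (transducer σ).Reads d κ' ∧ κ'.state.1 = v' := by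
  subst hv
  rw [← List.append_nil d]
  refine ⟨⟨⟨v', he.visits_right⟩, ⟨κ.state.1, κ.state.2, hc⟩ :: κ.stack⟩,
    .step _ _ _ none hr ⟨_, .store _ ⟨v', he.visits_right⟩ κ.top none he hc hch ha, ?_⟩, rfl⟩
  rw [List.cons_append, List.singleton_append, ← κ.content_eq]
  rfl

theorem reads_restore {d : List S.trans} {κ : Config (TState σ) (TSymbol σ)} {Z : TSymbol σ}
    {s : List (TSymbol σ)} {q q' p : Q} {A B C : WithBot Γ} {P R R' : Pred Q n} {c d' e : Fin n}
    {δ : S.trans} (hr : (transducer σ).Reads d κ) (hv : κ.state.1 = .check q A P c d')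
    (hs : κ.stack = Z :: s) (he : σ.VisitsEdge (.check q A P c d') (.win i p))
    (hZ : Z.1 = .claim R e q' B C R') (hj : σ.Visits (.jump p C R e c))
    (hδ : δ.1 = ⟨q, A, p, []⟩) :
    (transducer σ).Reads (d ++ [δ]) ⟨⟨.jump p C R e c, hj⟩, s⟩ := by
  obtain ⟨v, s₀⟩ := κ
  obtain rfl : s₀ = Z :: s := hs
  have hv : v.1 = _ := hv
  refine .step _ _ _ (some δ) hr ⟨[], .restore v ⟨.jump p C R e c, hj⟩ Z (some δ) q A P c d' p R e
    q' B C R' hv (hv ▸ he) ?_ hZ rfl, rfl⟩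
  rw [hv]
  simp [label, hδ]

theorem exists_check_of_jump (hpos : σ.Positional) {d : List S.trans}
    {κ : Config (TState σ) (TSymbol σ)} {q : Q} {A : WithBot Γ} {P : Pred Q n} {c e : Fin n}
    (hr : (transducer σ).Reads d κ) (hv : κ.state.1 = .jump q A P c e) :
    ∃ κ', (transducer σ).Reads d κ' ∧ κ'.state.1.IsCheck := by
  have he := (hv ▸ κ.state.2 : σ.Visits _).visitsEdge hpos
    (σ.move_of_owner_ne (v := .jump q A P c e) (one_sub_ne i) (.land q A P c e))
  have := reads_keep (a := none) hr hv he (by rintro ⟨_, _, _, _, _, _, h⟩; cases h)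
    (by rintro ⟨_, h⟩; cases h) rfl
  rw [Option.toList_none, List.append_nil] at this
  exact ⟨_, this, _, _, _, _, _, rfl⟩

theorem exists_check_of_claim (hpos : σ.Positional) {d : List S.trans}
    {κ : Config (TState σ) (TSymbol σ)} {p : Q} {B C : WithBot Γ} {P R : Pred Q n} {c : Fin n}
    (hr : (transducer σ).Reads d κ) (hv : κ.state.1 = .claim P c p B C R) :
    ∃ κ', (transducer σ).Reads d κ' ∧ κ'.state.1.IsCheck := by
  have he := (hv ▸ κ.state.2 : σ.Visits _).visitsEdge hpos
    (σ.move_of_owner_ne (v := .claim P c p B C R) (one_sub_ne i) (.verify P c p B C R))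
  obtain ⟨κ', h1, h2⟩ := reads_store hr hv he ⟨_, _, _, _, _, _, rfl⟩ ⟨_, _, _, _, _, rfl⟩ rfl
  exact ⟨κ', h1, _, _, _, _, _, h2⟩

theorem exists_check_of_push (hpos : σ.Positional) {d : List S.trans}
    {κ : Config (TState σ) (TSymbol σ)} {p : Q} {B C : WithBot Γ} {P : Pred Q n} {c : Fin n}
    (hr : (transducer σ).Reads d κ) (hv : κ.state.1 = .push P c p B C) :
    ∃ κ', (transducer σ).Reads d κ' ∧ κ'.state.1.IsCheck := by
  obtain ⟨v', hm⟩ := σ.exists_move (.push P c p B C)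
  have he := (hv ▸ κ.state.2 : σ.Visits _).visitsEdge hpos hm
  cases hm.1 with
  | predict _ _ _ _ _ R =>
    have := reads_keep (a := none) hr hv he (by rintro ⟨_, _, _, _, _, _, h⟩; cases h)
      (by rintro ⟨_, h⟩; cases h) rfl
    rw [Option.toList_none, List.append_nil] at this
    exact exists_check_of_claim hpos this rfl

/-- The transducer can therefore stop at any `Check`-vertex, which makes its output there defined in
the sense of `RunEndsIn`. -/
theorem not_step_none_of_isCheck (hpos : σ.Positional) (hwin : σ.Winning)
    {v v' : TState σ} {Z : WithBot (TSymbol σ)} {α : List (WithBot (TSymbol σ))}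
    (hv : v.1.IsCheck) : ¬ (transducer σ).trans v Z none v' α := by
  obtain ⟨v, hvis⟩ := v
  obtain ⟨v', hvis'⟩ := v'
  obtain ⟨q, A, P, c, d, rfl⟩ := hv
  intro h
  cases h with
  | keep _ _ _ he _ hw ha =>
    cases (he.move hpos).1 with
    | skip => simp [label] at ha
    | push => simp [label] at ha
    | popCorrect => simp [label] at ha
    | popWrong => exact Vertex.not_visits_win hwin _ he.visits_right
  | store _ _ _ _ hc =>
    obtain ⟨_, _, _, _, _, _, h⟩ := hc
    cases h
  | restore _ _ _ _ _ _ _ _ _ _ _ _ _ _ _ _ _ ha => simp [label] at ha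

theorem exists_label_of_move (hpos : σ.Positional) (hwin : σ.Winning) {q : Q} {A : WithBot Γ}
    {P : Pred Q n} {c d : Fin n} {v' : Vertex Q Γ n} (hv : σ.Visits (.check q A P c d))
    (hm : σ.Move (.check q A P c d) v') :
    ∃ δ : S.trans, label i (.check q A P c d) v' = some δ.1 ∧ δ.1.src = q ∧ δ.1.top = A := by
  have hv' := hv.of_move hpos hm
  cases hm.1 with
  | skip _ _ _ _ _ _ _ h => exact ⟨⟨_, h⟩, rfl, rfl, rfl⟩
  | push _ _ _ _ _ _ _ _ h => exact ⟨⟨_, h⟩, rfl, rfl, rfl⟩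
  | popCorrect _ _ _ _ _ _ h => exact ⟨⟨_, h⟩, by simp [label], rfl, rfl⟩
  | popWrong => exact absurd hv' (Vertex.not_visits_win hwin _)

theorem exists_out {v : TState σ} {v' : Vertex Q Γ n} {δ : S.trans} (hch : v.1.IsCheck)
    (ho : (finiteGame S owner col i).owner v.1 = i) (he : σ.VisitsEdge v.1 v')
    (hl : label i v.1 v' = some δ.1) : ∃ δ', (transducer σ).out v = some δ' :=
  ⟨_, dif_pos ⟨δ, hch, ho, v', he, hl⟩⟩

theorem of_out_eq_some {v : TState σ} {δ : S.trans} (h : (transducer σ).out v = some δ) :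
    v.1.IsCheck ∧ ∃ v', σ.VisitsEdge v.1 v' ∧ label i v.1 v' = some δ.1 := by
  simp only [transducer] at h
  split at h
  · next hex =>
    obtain ⟨hch, -, hex'⟩ := hex.choose_spec
    rw [Option.some.inj h] at hex'
    exact ⟨hch, hex'⟩
  · cases h

theorem exists_move_of_trans (hpos : σ.Positional) (hwin : σ.Winning) {q : Q}
    {A : WithBot Γ} {P : Pred Q n} {c d : Fin n} (hv : σ.Visits (.check q A P c d))
    (ho : owner q ≠ i) (δ : S.trans) (hq : δ.1.src = q) (hA : δ.1.top = A) :
    ∃ v', σ.Move (.check q A P c d) v' ∧ label i (.check q A P c d) v' = some δ.1 := by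
  obtain ⟨⟨q', A', p, α⟩, hδ⟩ := δ
  obtain rfl : q' = q := hq
  obtain rfl : A' = A := hA
  have hmove := fun v' => σ.move_of_owner_ne (v := .check q' A' P c d) (v' := v') ho
  have hlen : α.length ≤ 2 := (S.legal _ hδ).1
  match α, hδ, hlen with
  | [], hδ, _ =>
    by_cases hp : p ∈ P c
    · exact ⟨_, hmove _ (.popCorrect _ _ _ _ _ _ hδ hp), by simp [label]⟩
    · exact absurd (hv.of_move hpos (hmove _ (.popWrong _ _ _ _ _ _ hδ hp)))
        (Vertex.not_visits_win hwin _)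
  | [B], hδ, _ => exact ⟨_, hmove _ (.skip _ _ _ _ _ _ _ hδ), rfl⟩
  | [B, C], hδ, _ => exact ⟨_, hmove _ (.push _ _ _ _ _ _ _ _ hδ), rfl⟩

/-- After reading `d` the transducer can read any transition that labels a move of `σ` and is
executable in the simulated configuration. -/
theorem exists_reads_snoc (hpos : σ.Positional) (hwin : σ.Winning) {w : List (Config Q Γ)}
    {d : List S.trans} {κ : Config (TState σ) (TSymbol σ)} {x y : Config Q Γ}
    {q : Q} {A : WithBot Γ} {P : Pred Q n} {c d' : Fin n} {v' : Vertex Q Γ n} {δ : S.trans}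
    (hr : (transducer σ).Reads d κ) (hv : κ.state.1 = .check q A P c d')
    (hS : Sim σ w (.check q A P c d') κ.stack) (hx : w.getLast? = some x)
    (hm : σ.Move (.check q A P c d') v') (hl : label i (.check q A P c d') v' = some δ.1)
    (hf : Config.Fires δ.1 x y) :
    ∃ κ', (transducer σ).Reads (d ++ [δ]) κ' ∧ κ'.state.1.IsCheck := by
  have hvis := hS.track.visits
  have he := hvis.visitsEdge hpos hm
  have hncl : ¬ (Vertex.check q A P c d').IsClaim := by rintro ⟨_, _, _, _, _, _, h⟩; cases h
  cases hm.1 with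
  | skip =>
    exact ⟨_, reads_keep (a := some δ) hr hv he hncl (by rintro ⟨_, h⟩; cases h) hl.symm,
      _, _, _, _, _, rfl⟩
  | push =>
    exact exists_check_of_push hpos
      (reads_keep (a := some δ) hr hv he hncl (by rintro ⟨_, h⟩; cases h) hl.symm) rfl
  | popCorrect _ _ p _ _ _ _ hp =>
    have hδ : δ.1 = ⟨q, A, p, []⟩ := by
      have : some _ = some δ.1 := (if_pos rfl).symm.trans hl
      exact (Option.some.inj this).symm
    have hcont := hf.2.2.2
    rw [hδ] at hcont
    generalize hs : κ.stack = s at hS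
    cases hS with
    | base hx' hy =>
      obtain rfl := Option.some.inj (hx'.symm.trans hx)
      subst hy
      -- Without a pending claim only `⊥` is on the stack, and a pop would leave it empty.
      exact absurd hcont (Config.content_ne_nil _)
    | level hS hx hxc h1 h2 hZ =>
      -- The jump is reached by replaying the push from the earlier `Check`-vertex and letting the
      -- opponent believe the prediction.
      have hj := ((hS.track.visits.of_move hpos h1).of_move hpos h2).of_move hpos
        (σ.move_of_owner_ne (one_sub_ne i) (.believe _ _ _ _ _ _ _ _ hp))
      exact exists_check_of_jump hpos (reads_restore hr hv hs he hZ hj hδ) rfl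
  | popWrong => exact absurd he.visits_right (Vertex.not_visits_win hwin _)

/-- Every play prefix that is consistent with the transducer strategy is induced by a sequence of
transitions on which the transducer has a run that ends in a `Check`-vertex. -/
theorem exists_run (hpos : σ.Positional) (hwin : σ.Winning) (w : List (Config Q Γ))
    (hw : (pushdownGame S owner col).IsPlayPrefix w)
    (hcons : (transducerStrategy S owner col i (transducer σ)).Consistent w) :
    ∃ d κ, Induces S w d ∧ (transducer σ).Reads d κ ∧ κ.state.1.IsCheck := by
  induction w using List.reverseRecOn with
  | nil => cases hw.1
  | append_singleton w y ih =>
    rcases List.eq_nil_or_concat' w with rfl | ⟨u, x, rfl⟩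
    · exact ⟨[], _, .single y, .start, _, _, _, _, _, rfl⟩
    have hpre : u ++ [x] <+: u ++ [x] ++ [y] := List.prefix_append _ _
    have hw₀ := hw.of_prefix hpre (by simp)
    obtain ⟨d, κ, hd, hr, hch⟩ := ih hw₀ (hcons.of_prefix hpre)
    -- Stated for every run on `d`, because the run behind the strategy's output may differ from
    -- `κ`.
    have hsim : ∀ κ : Config (TState σ) (TSymbol σ), (transducer σ).Reads d κ →
        κ.state.1.IsCheck → ∃ A P c d', κ.state.1 = .check x.state A P c d' ∧ x.top = A ∧
          Sim σ (u ++ [x]) (.check x.state A P c d') κ.stack := by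
      rintro κ hr ⟨q, A, P, c, d', hκ⟩
      have := Aux.of_reads hpos hwin hr hd hw₀.1
      rw [hκ] at this
      have h := this.sim
      obtain ⟨x', X, hx', rfl, hc⟩ := h.last
      obtain rfl : x' = x := by simpa using hx'.symm
      obtain ⟨htop, -⟩ := List.cons_eq_cons.mp (x'.content_eq.symm.trans hc)
      exact ⟨A, P, c, d', hκ, htop, h⟩
    rw [List.append_assoc, List.singleton_append] at hw hcons ⊢
    suffices h : ∃ (δ : S.trans) (κ : Config (TState σ) (TSymbol σ)) (v' : Vertex Q Γ n),
        (transducer σ).Reads d κ ∧ κ.state.1.IsCheck ∧ σ.Move κ.state.1 v' ∧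
          label i κ.state.1 v' = some δ.1 ∧ Config.Fires δ.1 x y by
      obtain ⟨δ, κ, v', hr, hch, hm, hl, hf⟩ := h
      obtain ⟨A, P, c, d', hκ, -, hS⟩ := hsim κ hr hch
      rw [hκ] at hm hl
      obtain ⟨κ', hr', hch'⟩ := exists_reads_snoc hpos hwin hr hκ hS (by simp) hm hl hf
      exact ⟨_, κ', .snoc _ _ _ _ _ hd hf, hr', hch'⟩
    by_cases ho : owner x.state = i
    · have hy : y = (transducerStrategy S owner col i (transducer σ)).move u ⟨x, ho⟩ :=
        hcons u x y ho (List.prefix_refl _)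
      -- An executable output exists, so the strategy does not fall back on an arbitrary successor.
      have hex : ∃ v', ∃ d δ, Induces S (u ++ [x]) d ∧ (transducer σ).Outputs d δ ∧
          Config.Fires δ.1 x v' := by
        obtain ⟨A, P, c, d', hκ, htop, hS⟩ := hsim κ hr hch
        have hm := σ.move_move (v := .check x.state A P c d') ho
        have hvis := hS.track.visits
        obtain ⟨δ, hl, -⟩ := exists_label_of_move hpos hwin hvis hm
        obtain ⟨δ', hout⟩ := exists_out hch (by rw [hκ]; exact ho)
          (by rw [hκ]; exact hvis.visitsEdge hpos hm) (by rw [hκ]; exact hl)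
        obtain ⟨-, v', he, hl'⟩ := of_out_eq_some hout
        rw [hκ] at he hl'
        obtain ⟨δ₁, hl₁, h1, h2⟩ := exists_label_of_move hpos hwin hvis (he.move hpos)
        have hδ : δ'.1 = δ₁.1 := Option.some.inj (hl'.symm.trans hl₁)
        obtain ⟨y', hy'⟩ := Config.exists_fires (S.legal _ δ'.2) (v := x)
          (by rw [hδ, h1]) (by rw [hδ, h2, htop])
        exact ⟨y', d, δ', hd,
          ⟨κ, ⟨hr, fun _ _ => not_step_none_of_isCheck hpos hwin hch⟩, hout⟩, hy'⟩
      obtain ⟨d₁, δ, hd₁, ⟨κ₁, ⟨hr₁, -⟩, hout⟩, hf⟩ := hex.choose_spec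
      have hy' : y = hex.choose := hy.trans (dif_pos hex)
      rw [← hy'] at hf
      -- The chosen output belongs to a run on the same transition sequence; its final
      -- `Check`-vertex replaces the one of `κ`.
      obtain rfl := hd.unique hd₁
      obtain ⟨hch₁, v', he, hl⟩ := of_out_eq_some hout
      exact ⟨δ, κ₁, v', hr₁, hch₁, he.move hpos, hl, hf⟩
    · obtain ⟨δ, hδ, hf⟩ : (pushdownGame S owner col).edge x y := by
        simpa using hw.2.infix (l₁ := [x, y]) (List.suffix_append _ _).isInfix
      obtain ⟨A, P, c, d', hκ, htop, hS⟩ := hsim κ hr hch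
      obtain ⟨v', hm, hl⟩ := exists_move_of_trans hpos hwin hS.track.visits ho ⟨δ, hδ⟩
        hf.1.symm (hf.2.1.symm.trans htop)
      exact ⟨⟨δ, hδ⟩, κ, v', hr, hch, hκ ▸ hm, hκ ▸ hl, hf⟩

end Existence

end PushdownScores

theorem mainTheorem2 {Q Γ : Type*} [Finite Q] [Finite Γ] {n : ℕ}
    (S : PushdownScores.PDS Q Γ) (owner : Q → Fin 2) (col : Q → Fin n) (i : Fin 2)
    (σ' : (PushdownScores.finiteGame S owner col i).Strategy i)
    (hpos : σ'.Positional) (hwin : σ'.Winning)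
    (w : List (PushdownScores.Config Q Γ))
    (hw : (PushdownScores.pushdownGame S owner col).IsPlayPrefix w)
    (hcons : (PushdownScores.transducerStrategy S owner col i
      (PushdownScores.transducer σ')).Consistent w) :
    ∃ w' : List (PushdownScores.Vertex Q Γ n),
      (PushdownScores.finiteGame S owner col i).IsPlayPrefix w' ∧ σ'.Consistent w' ∧
      ∀ c : Fin n,
        PushdownScores.stairScore PushdownScores.Config.sh
            (PushdownScores.pushdownGame S owner col).col c w =
          PushdownScores.score (PushdownScores.finiteGame S owner col i).col c.castSucc w' := by
  obtain ⟨d, κ, hd, hr, q, A, P, c, d', hκ⟩ := PushdownScores.exists_run hpos hwin w hw hcons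
  -- The run ends in a `Check`-vertex, where the invariant includes the equality of scores for all
  -- of `w`.
  have h := PushdownScores.Aux.of_reads hpos hwin hr hd hw.1
  rw [hκ] at h
  obtain ⟨w', hw', hs⟩ := h.sim.track
  exact ⟨w', hw'.1, hw'.2.1, hs⟩
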